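/- **Setting.** Let $\mathcal X$ be a measurable space, $\mathcal Y\subseteq\mathbb R$, $Z_i=(X_i,Y_i)$, $i=1,\dots,n+1$, i.i.d. with values in $\mathcal X\times\mathcal Y$, and $\mathcal D_n=(Z_1,\dots,Z_n)$, $n\ge 2$. Let $\mu(x;\vartheta)\in\mathbb R$, $\vartheta\in\mathbb R^d$, be a model that is $L$-Lipschitz in $\vartheta$ for every $x$, and $\ell$ a loss such that $\vartheta\mapsto\ell(y,\mu(x;\vartheta))$ is $\rho L$-Lipschitz for all $(x,y)\in\mathcal X\times\mathcal Y$. Let $$J(\vartheta;\mathcal D_n)=\tfrac1n\sum_{i=1}^n\ell(Y_i,\mu(X_i;\vartheta))+\Omega(\vartheta),\qquad J(\vartheta;\mathcal D_{n+1})=J(\vartheta;\mathcal D_n)+\tfrac1n\ell(Y_{n+1},\mu(X_{n+1};\vartheta)),$$ where $J(\cdot\,;\mathcal D)$ is $\lambda$-strongly convex for every data set $\mathcal D$ of size $n$, and let $\hat\vartheta^{(n)},\hat\vartheta^{(n+1)}$ be minimizers of $J(\cdot\,;\mathcal D_n)$, $J(\cdot\,;\mathcal D_{n+1})$ (measurable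 functions of the data). Put $\tau=2\rho L/(\lambda n)$ and $$\tilde\vartheta^{(n)}=\hat\vartheta^{(n)}+\zeta,\qquad \zeta\sim\mathcal N(0,\sigma_1^2I_d)\ \text{independent of the data},\qquad \sigma_1^2=2\log(1.25/\delta)\,\tau^2/\varepsilon_1^2 .$$ Let $R_i^{(n)}=|Y_i-\mu(X_i;\tilde\vartheta^{(n)})|$, $i\le n$, and $R_i^{(n+1)}=|Y_i-\mu(X_i;\hat\vartheta^{(n+1)})|$, $i\le n+1$; write $R_{(k)}$ for the $k$-th smallest value of a score sequence. For $\alpha\in(0,1)$ put $\alpha_1=e^{-\varepsilon_1}(\alpha-\delta)$ and $\alpha_0=\alpha_1-\frac{2}{n\varepsilon_2}$, where $\alpha_1>\frac2{n\varepsilon_2}$ is required. *Private quantile.* Fix ranks $r_1,\dots,r_M\in\{1,\dots,n\}$ such that every $k\in\{1,\dots,n\}$ satisfies $|k-r_j|\le B$ for some $j$, and let $e_j=R^{(n)}_{(r_j)}$ (a rank-based grid). With $$w_j=\max\Big\{\tfrac{|\{i:R_i^{(n)}<e_j\}|}{1-\alpha_0},\tfrac{|\{i:R_i^{(n)}>e_j\}|}{\alpha_0}\Big\},\quad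 \Delta=\max\Big\{\tfrac1{1-\alpha_0},\tfrac1{\alpha_0}\Big\},\quad p_j=\exp\Big(-\tfrac{\varepsilon_2w_j}{2\Delta}\Big),$$ an index $\hat\jmath$ is selected with conditional probabilities $\Pr(\hat\jmath=j\mid Z_1,\dots,Z_{n+1},\zeta)=p_j/\sum_ip_i$, and $\hat q=e_{\hat\jmath}$. *Intervals.* With $X=X_{n+1}$ and $k=\lceil(1-\alpha)(n+1)\rceil$, let $$C^{dp}_\alpha(X)=\big[\mu(X;\tilde\vartheta^{(n)})-\hat q,\ \mu(X;\tilde\vartheta^{(n)})+\hat q\big],\qquad C^{o}_\alpha(X)=\big[\mu(X;\hat\vartheta^{(n+1)})-R^{(n+1)}_{(k)},\ \mu(X;\hat\vartheta^{(n+1)})+R^{(n+1)}_{(k)}\big].$$ *Assumptions.* There are a distribution function $F$ on $\mathbb R$ and a number $\xi_{TV}$ such that the joint laws of $(R^{(n)}_i)_{i\le n}$ and of $(R^{(n+1)}_i)_{i\le n+1}$ are each within total variation distance $\xi_{TV}$ of the law of an i.i.d. sequence (of the same length) with distribution function $F$. The quantile function $F^{-1}(q)=\inf\{x:F(x)\ge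 q\}$ satisfies $|F^{-1}(q_1)-F^{-1}(q_2)|\le h|q_1-q_2|^\gamma$ for all $q_1,q_2\in[1-\alpha-\epsilon_0,1-\alpha+\epsilon_0]\subset(0,1)$, where $\gamma\in(0,1]$, $\epsilon_0>0$. The budget is split evenly, $\varepsilon_1=\varepsilon_2=\varepsilon/2$, and for some $\eta\in(0,1)$ $$c_\varepsilon n^{-\eta}\le\varepsilon\le C_\varepsilon n^{-\eta},\qquad n^{-K}\le\delta\le C_\delta n^{-1},\qquad M\le C_Mn,\qquad c_\varepsilon>0 .$$ **Theorem.** There is a constant $C>0$, depending only on $d,\alpha,\eta,\gamma,h,\epsilon_0,\rho,L,\lambda,c_\varepsilon,C_\varepsilon,C_\delta,K,C_M,B$, such that in the above setting, for all $n\ge 2$ and all $t>0$, $$\Pr\Big(\mathrm{Leb}\big(C^o_\alpha(X)\,\triangle\,C^{dp}_\alpha(X)\big)>C\Big(\Big(\frac1{n^\eta}+\frac{\log n}{n^{1-\eta}}\Big)^{\gamma}+t\Big)\Big)\le C\Big(\frac1{n^{1-\eta}}+\frac1{n^\eta\log n}+\exp\Big(-\frac{n^{2-2\eta}t^2}{\log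 n}\Big)\Big)+3\,\xi_{TV}.$$ -/

import Mathlib

open MeasureTheory ProbabilityTheory

noncomputable section

namespace DPCP

/-! ### Order statistics, quantiles, total variation -/

/-- The `k`-th smallest (`1 ≤ k ≤ n`, with multiplicity) of the values `R 0, …, R (n - 1)`;
the value `0` outside that range of `k` is never used. -/
def kthSmallest {n : ℕ} (R : Fin n → ℝ) (k : ℕ) : ℝ :=
  if h : 1 ≤ k ∧ k ≤ n then R (Tuple.sort R ⟨k - 1, by omega⟩) else 0

/-- The quantile function `F⁻¹(q) = inf {x | q ≤ F x}` of the distribution function `F` of `ν`. -/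
def quantile (ν : Measure ℝ) (q : ℝ) : ℝ :=
  sInf {x : ℝ | q ≤ cdf ν x}

/-- Total variation distance `sup_A |P A - Q A|` over measurable sets `A`. -/
def tvDist {S : Type*} [MeasurableSpace S] (P Q : Measure S) : ℝ :=
  ⨆ A : {A : Set S // MeasurableSet A}, |P.real A - Q.real A|

/-- The random vector `R = (R₁, …, R_n)` is `ξ`-approximately i.i.d. with idealized
distribution `ν`: its joint law is within total variation `ξ` of the `n`-fold product of `ν`. -/
def ApproxIID {Ω : Type*} [MeasurableSpace Ω] (Prob : Measure Ω) {n : ℕ} (R : Ω → Fin n → ℝ)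
    (ν : Measure ℝ) (ξ : ℝ) : Prop :=
  tvDist (Prob.map R) (Measure.pi fun _ : Fin n => ν) ≤ ξ

/-! ### The private quantile mechanism (exponential mechanism) -/

/-- `α₀ = β - 2 / (N ε)`. -/
def alphaZero (β : ℝ) (N : ℕ) (ε : ℝ) : ℝ := β - 2 / (N * ε)

/-- The penalty `w(e) = max (#{i | R_i < e} / (1 - α₀)) (#{i | R_i > e} / α₀)` of a threshold `e`. -/
def dpqPenalty (α₀ : ℝ) {N : ℕ} (R : Fin N → ℝ) (e : ℝ) : ℝ :=
  max ((Finset.univ.filter fun i => R i < e).card / (1 - α₀))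
    ((Finset.univ.filter fun i => e < R i).card / α₀)

/-- `Δ = max (1 / (1 - α₀)) (1 / α₀)`. -/
def dpqSensitivity (α₀ : ℝ) : ℝ := max (1 / (1 - α₀)) (1 / α₀)

/-- The unnormalized selection weight `p(e) = exp (- ε w(e) / (2 Δ))`. -/
def dpqWeight (ε α₀ : ℝ) {N : ℕ} (R : Fin N → ℝ) (e : ℝ) : ℝ :=
  Real.exp (-(ε * dpqPenalty α₀ R e / (2 * dpqSensitivity α₀)))

/-- The probability with which the private quantile mechanism with input level `β` and privacy
level `ε`, run on the scores `R` and the candidate thresholds `e`, selects `e j`. -/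
def dpqProb (β ε : ℝ) {N M : ℕ} (R : Fin N → ℝ) (e : Fin M → ℝ) (j : Fin M) : ℝ :=
  dpqWeight ε (alphaZero β N ε) R (e j) / ∑ i, dpqWeight ε (alphaZero β N ε) R (e i)

/-- Candidate ranks `r 0, …, r (M - 1)` in `{1, …, n}` such that every rank in `{1, …, n}` is at
distance at most `B` from a candidate rank. -/
def IsRankGrid (n M B : ℕ) (r : Fin M → ℕ) : Prop :=
  (∀ j, 1 ≤ r j ∧ r j ≤ n) ∧
    ∀ k : ℕ, 1 ≤ k → k ≤ n → ∃ j, |(r j : ℤ) - (k : ℤ)| ≤ (B : ℤ)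

/-- The rank-based grid of thresholds: the order statistics of the scores at the candidate ranks. -/
def rankGrid {n M : ℕ} (r : Fin M → ℕ) (R : Fin n → ℝ) (j : Fin M) : ℝ :=
  kthSmallest R (r j)

/-! ### Empirical risk minimization with Gaussian output perturbation -/

section ERM

variable {𝒳 : Type*} {𝒴 : Set ℝ} {d n M : ℕ}

/-- The regularized empirical risk
`J(ϑ; D) = (1/n) ∑ᵢ ℓ(Yᵢ, μ(Xᵢ; ϑ)) + reg(ϑ)` of a data set `D` of size `n`. -/
def objective (ℓ : ℝ → ℝ → ℝ) (μ : 𝒳 → EuclideanSpace ℝ (Fin d) → ℝ)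
    (reg : EuclideanSpace ℝ (Fin d) → ℝ) (D : Fin n → 𝒳 × 𝒴)
    (ϑ : EuclideanSpace ℝ (Fin d)) : ℝ :=
  (1 / n) * ∑ i, ℓ ((D i).2 : ℝ) (μ (D i).1 ϑ) + reg ϑ

/-- The objective of the augmented data set `D = (Z₁, …, Z_n, Z_{n+1})`:
`J(ϑ; D) = J(ϑ; (Z₁, …, Z_n)) + (1/n) ℓ(Y_{n+1}, μ(X_{n+1}; ϑ))`. -/
def augObjective (ℓ : ℝ → ℝ → ℝ) (μ : 𝒳 → EuclideanSpace ℝ (Fin d) → ℝ)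
    (reg : EuclideanSpace ℝ (Fin d) → ℝ) (D : Fin (n + 1) → 𝒳 × 𝒴)
    (ϑ : EuclideanSpace ℝ (Fin d)) : ℝ :=
  objective ℓ μ reg (Fin.init D) ϑ
    + (1 / n) * ℓ ((D (Fin.last n)).2 : ℝ) (μ (D (Fin.last n)).1 ϑ)

/-- `τ = 2 ρ L / (λ n)`. -/
def tau (ρ L lam : ℝ) (n : ℕ) : ℝ := 2 * (ρ * L) / (lam * n)

/-- `σ₁² = 2 log (1.25 / δ) τ² / ε₁²`. -/
def noiseVariance (ρ L lam : ℝ) (n : ℕ) (ε₁ δ : ℝ) : ℝ :=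
  2 * Real.log (1.25 / δ) * tau ρ L lam n ^ 2 / ε₁ ^ 2

/-- The noise distribution `N(0, σ₁² I_d)`. -/
def noiseLaw (d : ℕ) (ρ L lam : ℝ) (n : ℕ) (ε₁ δ : ℝ) : Measure (EuclideanSpace ℝ (Fin d)) :=
  multivariateGaussian 0 (noiseVariance ρ L lam n ε₁ δ • (1 : Matrix (Fin d) (Fin d) ℝ))

/-- `α₁ = exp (-ε₁) (α - δ)`. -/
def alphaOne (α ε₁ δ : ℝ) : ℝ := Real.exp (-ε₁) * (α - δ)

/-- The absolute residual score `|y - μ(x; ϑ)|`. -/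
def score (μ : 𝒳 → EuclideanSpace ℝ (Fin d) → ℝ) (ϑ : EuclideanSpace ℝ (Fin d))
    (z : 𝒳 × 𝒴) : ℝ :=
  |(z.2 : ℝ) - μ z.1 ϑ|

/-- The private parameter: the ERM estimator `est` on the first `n` observations of
`D = (Z₁, …, Z_{n+1})`, plus the noise `z`. -/
def privParam (est : (Fin n → 𝒳 × 𝒴) → EuclideanSpace ℝ (Fin d))
    (D : Fin (n + 1) → 𝒳 × 𝒴) (z : EuclideanSpace ℝ (Fin d)) : EuclideanSpace ℝ (Fin d) :=
  est (Fin.init D) + z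

/-- The scores `R_i^{(n)}`, `i = 1, …, n`, of the first `n` observations under the private
parameter. -/
def privScores (μ : 𝒳 → EuclideanSpace ℝ (Fin d) → ℝ)
    (est : (Fin n → 𝒳 × 𝒴) → EuclideanSpace ℝ (Fin d))
    (D : Fin (n + 1) → 𝒳 × 𝒴) (z : EuclideanSpace ℝ (Fin d)) : Fin n → ℝ :=
  fun i => score μ (privParam est D z) (D i.castSucc)

/-- The scores `R_i^{(n+1)}`, `i = 1, …, n + 1`, of all observations under the noiseless ERM
estimator of the augmented data set. -/
def oracleScores (μ : 𝒳 → EuclideanSpace ℝ (Fin d) → ℝ)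
    (estAug : (Fin (n + 1) → 𝒳 × 𝒴) → EuclideanSpace ℝ (Fin d))
    (D : Fin (n + 1) → 𝒳 × 𝒴) : Fin (n + 1) → ℝ :=
  fun i => score μ (estAug D) (D i)

/-- The oracle interval at `X_{n+1}`: centre `μ(X_{n+1}; estAug D)`, radius the `k`-th smallest
oracle score, `k = ⌈(1 - α)(n + 1)⌉`. -/
def oracleInterval (μ : 𝒳 → EuclideanSpace ℝ (Fin d) → ℝ)
    (estAug : (Fin (n + 1) → 𝒳 × 𝒴) → EuclideanSpace ℝ (Fin d)) (α : ℝ)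
    (D : Fin (n + 1) → 𝒳 × 𝒴) : Set ℝ :=
  let c := μ (D (Fin.last n)).1 (estAug D)
  let q := kthSmallest (oracleScores μ estAug D) ⌈(1 - α) * ((n : ℝ) + 1)⌉₊
  Set.Icc (c - q) (c + q)

/-- The DPCP interval at `X_{n+1}`, when the private quantile mechanism has selected the `j`-th
threshold of the rank-based grid. -/
def dpcpInterval (μ : 𝒳 → EuclideanSpace ℝ (Fin d) → ℝ)
    (est : (Fin n → 𝒳 × 𝒴) → EuclideanSpace ℝ (Fin d)) (r : Fin M → ℕ)
    (D : Fin (n + 1) → 𝒳 × 𝒴) (z : EuclideanSpace ℝ (Fin d)) (j : Fin M) : Set ℝ :=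
  let c := μ (D (Fin.last n)).1 (privParam est D z)
  let q := rankGrid r (privScores μ est D z) j
  Set.Icc (c - q) (c + q)

end ERM

end DPCP

end

/-!
The Lebesgue measure of the symmetric difference of two intervals is at most twice the distance of
their centres plus twice the difference of their radii (`volume_symmDiff_Icc_le`), so the theorem
splits into a bound for the centres and a bound for the radii.

*Centres.* By strong convexity the minimizer moves by `O(1 / n)` when one observation is added
(`norm_estAug_sub_est_le`), and the added Gaussian noise has coordinates of variance
`O(log n / n ^ (2 - 2 η))`, which yields the exponential term of the bound
(`measureReal_noiseLaw_norm_gt_le`).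

*Radii.* Write `u = n ^ (-η) + log n / n ^ (1 - η)`. Both radii are compared with the quantiles of
the idealized distribution `ν` at the levels `1 - α ± A u`. A score vector is typical
(`typicalSet`) if the fraction of its entries strictly below the lower quantile exceeds the lower
level by less than `u`, and the fraction weakly below the upper quantile falls short of the upper
level by less than `u`. By Hoeffding's inequality an i.i.d. vector fails to be typical with
probability at most `2 exp (-2 n u ^ 2)`. Since the two summands of `u` have product `log n / n`,
this is at most `2 / n` for every `η` (`exp_neg_rate_sq_le`), and passing to the actual scores costs
one total variation error for each of the two score vectors. For typical scores, any threshold with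
nearly the right numbers of scores strictly below and strictly above it lies between the two
quantiles (`mem_Icc_quantile_of_mem_typicalSet`), whether or not there are ties. The oracle radius
is such a threshold because it is an order statistic. The private one is such a threshold because
the exponential mechanism selects, outside an event of probability `M / n ^ 2`, a grid point whose
penalty exceeds the minimum by `O(n u)` (`measureReal_dpqPenalty_gt_le`, `rank_loss_le`), and because
its target level `α₀` is within `O(u)` of `α` (`sub_alphaZero_le`). The Hölder condition then bounds
the difference of the radii by `O(u ^ γ)`.

The constants of these estimates are controlled only when `A u` is small, that is, from some `N₀` on;
for `n < N₀` the choice `C ≥ N₀` makes the claimed bound at least `1`.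
-/

namespace DPCP

/-! ### Order statistics -/

lemma card_lt_kthSmallest {n k : ℕ} (R : Fin n → ℝ) (h1 : 1 ≤ k) (h2 : k ≤ n) :
    (Finset.univ.filter fun i => R i < kthSmallest R k).card + 1 ≤ k := by
  have hk : kthSmallest R k = R (Tuple.sort R ⟨k - 1, by omega⟩) := dif_pos ⟨h1, h2⟩
  have hmono := Tuple.monotone_sort R
  have hsub : (Finset.univ.filter fun i => R i < kthSmallest R k) ⊆
      (Finset.Iio (⟨k - 1, by omega⟩ : Fin n)).map (Tuple.sort R).toEmbedding := by
    intro i hi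
    rw [Finset.mem_filter, hk] at hi
    refine Finset.mem_map.2 ⟨(Tuple.sort R).symm i, ?_, by simp⟩
    rw [Finset.mem_Iio]
    by_contra hle
    have := hmono (not_lt.1 hle)
    simp only [Function.comp_apply, Equiv.apply_symm_apply] at this
    exact absurd hi.2 (not_lt.2 this)
  have := Finset.card_le_card hsub
  rw [Finset.card_map, Fin.card_Iio] at this
  simp only at this
  omega

lemma card_kthSmallest_lt {n k : ℕ} (R : Fin n → ℝ) (h1 : 1 ≤ k) (h2 : k ≤ n) :
    (Finset.univ.filter fun i => kthSmallest R k < R i).card + k ≤ n := by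
  have hk : kthSmallest R k = R (Tuple.sort R ⟨k - 1, by omega⟩) := dif_pos ⟨h1, h2⟩
  have hmono := Tuple.monotone_sort R
  have hsub : (Finset.univ.filter fun i => kthSmallest R k < R i) ⊆
      (Finset.Ioi (⟨k - 1, by omega⟩ : Fin n)).map (Tuple.sort R).toEmbedding := by
    intro i hi
    rw [Finset.mem_filter, hk] at hi
    refine Finset.mem_map.2 ⟨(Tuple.sort R).symm i, ?_, by simp⟩
    rw [Finset.mem_Ioi]
    by_contra hle
    have := hmono (not_lt.1 hle)
    simp only [Function.comp_apply, Equiv.apply_symm_apply] at this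
    exact absurd hi.2 (not_lt.2 this)
  have := Finset.card_le_card hsub
  rw [Finset.card_map, Fin.card_Ioi] at this
  simp only at this
  omega

/-! ### Typical score vectors -/

/-- The score vectors whose empirical distribution puts mass less than `p₁ + u` strictly below the
`p₁`-quantile of `ν`, and mass more than `p₂ - u` weakly below the `p₂`-quantile of `ν`. -/
def typicalSet (ν : Measure ℝ) (p₁ p₂ u : ℝ) (N : ℕ) : Set (Fin N → ℝ) :=
  {R | ((Finset.univ.filter fun i => R i < quantile ν p₁).card : ℝ) < N * (p₁ + u) ∧
    N * (p₂ - u) < ((Finset.univ.filter fun i => R i ≤ quantile ν p₂).card : ℝ)}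

/-- A threshold whose empirical rank in a typical score vector is neither too high nor too low lies
between the two quantiles of `ν`. Ties among the scores are harmless: only the numbers of scores
strictly below and strictly above the threshold enter. -/
lemma mem_Icc_quantile_of_mem_typicalSet {ν : Measure ℝ} {p₁ p₂ u : ℝ} {N : ℕ} {R : Fin N → ℝ}
    (hR : R ∈ typicalSet ν p₁ p₂ u N) {q : ℝ}
    (hlt : ((Finset.univ.filter fun i => R i < q).card : ℝ) ≤ N * (p₂ - u))
    (hgt : ((Finset.univ.filter fun i => q < R i).card : ℝ) ≤ N * (1 - p₁ - u)) :
    q ∈ Set.Icc (quantile ν p₁) (quantile ν p₂) := by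
  constructor
  · by_contra! hq
    have hcompl := Finset.card_filter_add_card_filter_not (s := (Finset.univ : Finset (Fin N)))
      (fun i => R i < quantile ν p₁)
    have hle : (Finset.univ.filter fun i => ¬ R i < quantile ν p₁).card ≤
        (Finset.univ.filter fun i => q < R i).card :=
      Finset.card_le_card fun i hi => by
        simp only [Finset.mem_filter, Finset.mem_univ, true_and, not_lt] at hi ⊢
        exact hq.trans_le hi
    simp only [Finset.card_univ, Fintype.card_fin] at hcompl
    have h1 : ((Finset.univ.filter fun i => R i < quantile ν p₁).card : ℝ) +
      (Finset.univ.filter fun i => ¬ R i < quantile ν p₁).card = N := by exact_mod_cast hcompl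
    have h2 : ((Finset.univ.filter fun i => ¬ R i < quantile ν p₁).card : ℝ) ≤
      (Finset.univ.filter fun i => q < R i).card := by exact_mod_cast hle
    have := hR.1
    nlinarith
  · by_contra! hq
    have hle : (Finset.univ.filter fun i => R i ≤ quantile ν p₂).card ≤
        (Finset.univ.filter fun i => R i < q).card :=
      Finset.card_le_card fun i hi => by
        simp only [Finset.mem_filter, Finset.mem_univ, true_and] at hi ⊢
        exact hi.trans_lt hq
    have h2 : ((Finset.univ.filter fun i => R i ≤ quantile ν p₂).card : ℝ) ≤
      (Finset.univ.filter fun i => R i < q).card := by exact_mod_cast hle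
    exact absurd hR.2 (not_lt.2 (h2.trans hlt))

/-- The oracle radius, a `⌈(1 - α) N⌉`-th order statistic, of a typical score vector. -/
lemma kthSmallest_ceil_mem_Icc {ν : Measure ℝ} {α a u : ℝ} {N : ℕ} {R : Fin N → ℝ}
    (hα : 0 < α) (hα' : α < 1) (hN : 0 < N) (hua : u ≤ a)
    (hR : R ∈ typicalSet ν (1 - α - a) (1 - α + a) u N) :
    kthSmallest R ⌈(1 - α) * (N : ℝ)⌉₊ ∈
      Set.Icc (quantile ν (1 - α - a)) (quantile ν (1 - α + a)) := by
  have hN' : (0 : ℝ) < N := by exact_mod_cast hN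
  set k := ⌈(1 - α) * (N : ℝ)⌉₊ with hk
  have h0 : 0 < (1 - α) * (N : ℝ) := mul_pos (by linarith) hN'
  have h1 : 1 ≤ k := Nat.ceil_pos.2 h0
  have h2 : k ≤ N := Nat.ceil_le.2 (by nlinarith)
  have h3 : (1 - α) * (N : ℝ) ≤ k := Nat.le_ceil _
  have h4 : (k : ℝ) < (1 - α) * (N : ℝ) + 1 := Nat.ceil_lt_add_one h0.le
  have h5 : ((Finset.univ.filter fun i => R i < kthSmallest R k).card : ℝ) + 1 ≤ k := by
    exact_mod_cast card_lt_kthSmallest R h1 h2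
  have h6 : ((Finset.univ.filter fun i => kthSmallest R k < R i).card : ℝ) + k ≤ N := by
    exact_mod_cast card_kthSmallest_lt R h1 h2
  have h7 : 0 ≤ N * (a - u) := mul_nonneg hN'.le (by linarith)
  exact mem_Icc_quantile_of_mem_typicalSet hR (by nlinarith) (by nlinarith)

/-! ### Quantiles and concentration of empirical counts -/

lemma bddBelow_cdf_ge (ν : Measure ℝ) {p : ℝ} (hp : 0 < p) :
    BddBelow {x : ℝ | p ≤ cdf ν x} := by
  obtain ⟨x₀, hx₀⟩ := ((tendsto_cdf_atBot ν).eventually_lt_const hp).exists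
  refine ⟨x₀, fun x hx => ?_⟩
  by_contra! h
  exact absurd (hx.trans (monotone_cdf ν h.le)) (not_le.2 hx₀)

lemma le_cdf_quantile (ν : Measure ℝ) {p : ℝ} (hp' : p < 1) :
    p ≤ cdf ν (quantile ν p) := by
  have hne : {x : ℝ | p ≤ cdf ν x}.Nonempty :=
    (((tendsto_cdf_atTop ν).eventually_const_lt hp').exists).imp fun _ h => h.le
  have hcont := ((cdf ν).right_continuous (quantile ν p)).mono Set.Ioi_subset_Ici_self
  refine ge_of_tendsto hcont ?_
  filter_upwards [self_mem_nhdsWithin] with x hx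
  obtain ⟨y, hy, hyx⟩ := exists_lt_of_csInf_lt hne hx
  exact le_trans hy (monotone_cdf ν hyx.le)

lemma measureReal_Iio_quantile_le (ν : Measure ℝ) [IsProbabilityMeasure ν] {p : ℝ} (hp : 0 < p) :
    ν.real (Set.Iio (quantile ν p)) ≤ p := by
  have hlim := (monotone_cdf ν).tendsto_leftLim (quantile ν p)
  have hle : Function.leftLim (cdf ν) (quantile ν p) ≤ p := by
    refine le_of_tendsto hlim ?_
    filter_upwards [self_mem_nhdsWithin] with x hx
    by_contra! h
    exact absurd (csInf_le (bddBelow_cdf_ge ν hp) (show x ∈ {x : ℝ | p ≤ cdf ν x} from h.le))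
      (not_le.2 hx)
  have := (cdf ν).measure_Iio (tendsto_cdf_atBot ν) (quantile ν p)
  rw [measure_cdf, sub_zero] at this
  rw [measureReal_def, this]
  exact ENNReal.toReal_le_of_le_ofReal hp.le (ENNReal.ofReal_le_ofReal hle)

open Classical in
/-- Hoeffding's inequality for the number of points of an i.i.d. sample that fall into a set. -/
lemma measureReal_pi_card_ge_le (ν : Measure ℝ) [IsProbabilityMeasure ν] {A : Set ℝ}
    (hA : MeasurableSet A) {N : ℕ} (hN : 0 < N) {u : ℝ} (hu : 0 ≤ u) :
    (Measure.pi fun _ : Fin N => ν).real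
      {R | N * (ν.real A + u) ≤ ((Finset.univ.filter fun i => R i ∈ A).card : ℝ)} ≤
      Real.exp (-(2 * N * u ^ 2)) := by
  set X : Fin N → (Fin N → ℝ) → ℝ := fun i R => A.indicator 1 (R i) - ν.real A with hX
  have hind : iIndepFun X (Measure.pi fun _ : Fin N => ν) :=
    iIndepFun_pi (X := fun _ x => A.indicator 1 x - ν.real A) fun i =>
      ((measurable_one.indicator hA).sub_const _).aemeasurable
  have hsub : ∀ i ∈ Finset.univ, HasSubgaussianMGF (X i) ((‖(1 : ℝ) - 0‖₊ / 2) ^ 2)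
      (Measure.pi fun _ : Fin N => ν) := by
    intro i _
    have hm : Measurable fun R : Fin N → ℝ => A.indicator (1 : ℝ → ℝ) (R i) :=
      (measurable_one.indicator hA).comp (measurable_pi_apply i)
    have := hasSubgaussianMGF_of_mem_Icc (μ := Measure.pi fun _ : Fin N => ν) (a := 0) (b := 1)
      hm.aemeasurable (Filter.Eventually.of_forall fun R => by
        by_cases h : R i ∈ A <;> simp [h])
    have hint : ∫ R, A.indicator (1 : ℝ → ℝ) (R i) ∂(Measure.pi fun _ : Fin N => ν) = ν.real A := by
      rw [integral_comp_eval (μ := fun _ : Fin N => ν) (i := i)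
        (f := A.indicator (1 : ℝ → ℝ)) (measurable_one.indicator hA).aestronglyMeasurable]
      exact integral_indicator_one hA
    rwa [hint] at this
  have hN' : (0 : ℝ) < N := by exact_mod_cast hN
  have key := HasSubgaussianMGF.measure_sum_ge_le_of_iIndepFun hind hsub
    (ε := N * u) (by positivity)
  have hset : {R : Fin N → ℝ |
      N * (ν.real A + u) ≤ ((Finset.univ.filter fun i => R i ∈ A).card : ℝ)} =
      {R | N * u ≤ ∑ i, X i R} := by
    ext R
    have : ∑ i, X i R = ((Finset.univ.filter fun i => R i ∈ A).card : ℝ) - N * ν.real A := by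
      simp [hX, Finset.sum_sub_distrib, Set.indicator_apply]
    rw [Set.mem_ofPred_eq, Set.mem_ofPred_eq, this, mul_add]
    constructor <;> intro h <;> linarith
  rw [hset]
  refine key.trans (Real.exp_le_exp.2 (le_of_eq ?_))
  simp
  field_simp

open Classical in
lemma measureReal_pi_card_le_le (ν : Measure ℝ) [IsProbabilityMeasure ν] {A : Set ℝ}
    (hA : MeasurableSet A) {N : ℕ} (hN : 0 < N) {u : ℝ} (hu : 0 ≤ u) :
    (Measure.pi fun _ : Fin N => ν).real
      {R | ((Finset.univ.filter fun i => R i ∈ A).card : ℝ) ≤ N * (ν.real A - u)} ≤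
      Real.exp (-(2 * N * u ^ 2)) := by
  refine le_trans (measureReal_mono fun R hR => ?_)
    (measureReal_pi_card_ge_le ν hA.compl hN hu)
  have hcard := Finset.card_filter_add_card_filter_not (s := (Finset.univ : Finset (Fin N)))
    (fun i => R i ∈ A)
  simp only [Finset.card_univ, Fintype.card_fin] at hcard
  have hcard' : ((Finset.univ.filter fun i => R i ∈ A).card : ℝ) +
    (Finset.univ.filter fun i => R i ∉ A).card = N := by exact_mod_cast hcard
  simp only [Set.mem_ofPred_eq, Set.mem_compl_iff] at hR ⊢
  rw [probReal_compl_eq_one_sub hA]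
  linarith

lemma measurableSet_typicalSet (ν : Measure ℝ) (p₁ p₂ u : ℝ) (N : ℕ) :
    MeasurableSet (typicalSet ν p₁ p₂ u N) := by
  have h (s : Set ℝ) [DecidablePred (· ∈ s)] (hs : MeasurableSet s) :
      Measurable fun R : Fin N → ℝ => ((Finset.univ.filter fun i => R i ∈ s).card : ℝ) := by
    have : (fun R : Fin N → ℝ => ((Finset.univ.filter fun i => R i ∈ s).card : ℝ)) =
        fun R => ∑ i, s.indicator (1 : ℝ → ℝ) (R i) := by
      ext R
      simp [Set.indicator_apply]
    rw [this]
    exact Finset.measurable_sum _ fun i _ =>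
      (measurable_one.indicator hs).comp (measurable_pi_apply i)
  exact (measurableSet_lt (h (Set.Iio (quantile ν p₁)) measurableSet_Iio) measurable_const).inter
    (measurableSet_lt measurable_const (h (Set.Iic (quantile ν p₂)) measurableSet_Iic))

lemma measureReal_pi_compl_typicalSet_le (ν : Measure ℝ) [IsProbabilityMeasure ν] {p₁ p₂ u : ℝ}
    (hp₁ : 0 < p₁) (hp₂ : p₂ < 1) (hu : 0 ≤ u) {N : ℕ} (hN : 0 < N) :
    (Measure.pi fun _ : Fin N => ν).real (typicalSet ν p₁ p₂ u N)ᶜ ≤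
      2 * Real.exp (-(2 * N * u ^ 2)) := by
  classical
  have h1 := measureReal_pi_card_ge_le ν (measurableSet_Iio (a := quantile ν p₁)) hN hu
  have h2 := measureReal_pi_card_le_le ν (measurableSet_Iic (a := quantile ν p₂)) hN hu
  have hq1 := measureReal_Iio_quantile_le ν hp₁
  have hq2 : p₂ ≤ ν.real (Set.Iic (quantile ν p₂)) := by
    rw [← cdf_eq_real]; exact le_cdf_quantile ν hp₂
  refine (measureReal_mono (fun R hR => ?_)).trans ((measureReal_union_le _ _).trans
    ((add_le_add h1 h2).trans_eq (two_mul _).symm))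
  by_contra hcon
  simp only [Set.mem_union, Set.mem_ofPred_eq, not_or, not_le, Set.mem_Iio, Set.mem_Iic] at hcon
  refine hR ⟨?_, ?_⟩
  · refine lt_of_lt_of_le ?_ (mul_le_mul_of_nonneg_left (add_le_add_left hq1 u) N.cast_nonneg)
    convert hcon.1
  · refine lt_of_le_of_lt (mul_le_mul_of_nonneg_left (sub_le_sub_right hq2 u) N.cast_nonneg) ?_
    convert hcon.2

/-! ### Total variation -/

lemma abs_measureReal_sub_le_tvDist {S : Type*} [MeasurableSpace S] (P Q : Measure S)
    [IsProbabilityMeasure P] [IsProbabilityMeasure Q] {A : Set S} (hA : MeasurableSet A) :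
    |P.real A - Q.real A| ≤ tvDist P Q := by
  refine le_ciSup (f := fun A : {A : Set S // MeasurableSet A} => |P.real A - Q.real A|)
    ⟨1, ?_⟩ ⟨A, hA⟩
  rintro _ ⟨B, rfl⟩
  have h1 : P.real B ≤ 1 := measureReal_le_one
  have h2 : Q.real B ≤ 1 := measureReal_le_one
  have h3 : 0 ≤ P.real B := measureReal_nonneg
  have h4 : 0 ≤ Q.real B := measureReal_nonneg
  exact abs_le.2 ⟨by linarith, by linarith⟩

section

variable {Ω : Type*} [MeasurableSpace Ω] {Prob : Measure Ω} [IsProbabilityMeasure Prob] {N : ℕ}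
  {R : Ω → Fin N → ℝ} {ν : Measure ℝ} [IsProbabilityMeasure ν] {ξ : ℝ}

lemma ApproxIID.nonneg (hR : Measurable R) (h : ApproxIID Prob R ν ξ) : 0 ≤ ξ := by
  have := Measure.isProbabilityMeasure_map (μ := Prob) hR.aemeasurable
  exact ((abs_nonneg _).trans (abs_measureReal_sub_le_tvDist _ _ MeasurableSet.univ)).trans h

/-- Approximately i.i.d. scores are typical up to the Hoeffding bound and the total variation
error. -/
lemma ApproxIID.measureReal_notMem_typicalSet_le (hR : Measurable R) (h : ApproxIID Prob R ν ξ)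
    {p₁ p₂ u : ℝ} (hp₁ : 0 < p₁) (hp₂ : p₂ < 1) (hu : 0 ≤ u) (hN : 0 < N) :
    Prob.real {ω | R ω ∉ typicalSet ν p₁ p₂ u N} ≤ 2 * Real.exp (-(2 * N * u ^ 2)) + ξ := by
  have := Measure.isProbabilityMeasure_map (μ := Prob) hR.aemeasurable
  have hm := (measurableSet_typicalSet ν p₁ p₂ u N).compl
  have h1 := (abs_le.1 ((abs_measureReal_sub_le_tvDist _ _ hm).trans h)).2
  have h2 := measureReal_pi_compl_typicalSet_le ν hp₁ hp₂ hu hN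
  rw [map_measureReal_apply hR hm] at h1
  have : R ⁻¹' (typicalSet ν p₁ p₂ u N)ᶜ = {ω | R ω ∉ typicalSet ν p₁ p₂ u N} := rfl
  rw [this] at h1
  linarith

end

/-! ### The private quantile mechanism -/

lemma dpqSensitivity_pos {α₀ : ℝ} (h0 : 0 < α₀) : 0 < dpqSensitivity α₀ :=
  lt_max_of_lt_right (by positivity)

/-- A threshold whose penalty exceeds that of some candidate by `s` is selected with probability
exponentially small in `s`. -/
lemma dpqProb_le {β ε : ℝ} {N M : ℕ} (R : Fin N → ℝ) (e : Fin M → ℝ) (i j : Fin M) {s : ℝ}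
    (hε : 0 < ε) (h0 : 0 < alphaZero β N ε)
    (hs : dpqPenalty (alphaZero β N ε) R (e i) + s ≤ dpqPenalty (alphaZero β N ε) R (e j)) :
    dpqProb β ε R e j ≤ Real.exp (-(ε * s / (2 * dpqSensitivity (alphaZero β N ε)))) := by
  have hΔ := dpqSensitivity_pos h0
  have hpos : ∀ k, 0 < dpqWeight ε (alphaZero β N ε) R (e k) := fun k => Real.exp_pos _
  have hsum : dpqWeight ε (alphaZero β N ε) R (e i) ≤
      ∑ k, dpqWeight ε (alphaZero β N ε) R (e k) :=
    Finset.single_le_sum (f := fun k => dpqWeight ε (alphaZero β N ε) R (e k))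
      (fun k _ => (hpos k).le) (Finset.mem_univ i)
  unfold dpqProb
  rw [div_le_iff₀ ((hpos i).trans_le hsum)]
  refine le_trans ?_ (mul_le_mul_of_nonneg_left hsum (Real.exp_pos _).le)
  unfold dpqWeight
  rw [← Real.exp_add, Real.exp_le_exp, ← neg_add, neg_le_neg_iff, ← add_div, ← mul_add]
  gcongr
  linarith

lemma dpqPenalty_kthSmallest_le {α₀ : ℝ} (h0 : 0 < α₀) (h1 : α₀ < 1) {N k : ℕ} {b : ℝ}
    (R : Fin N → ℝ) (hk : 1 ≤ k) (hk' : k ≤ N)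
    (hub : (k : ℝ) ≤ (1 - α₀) * N + b + 1) (hlb : (1 - α₀) * N - b ≤ k) (hb : 0 ≤ b) :
    dpqPenalty α₀ R (kthSmallest R k) ≤ N + b * dpqSensitivity α₀ := by
  have h5 : ((Finset.univ.filter fun i => R i < kthSmallest R k).card : ℝ) + 1 ≤ k := by
    exact_mod_cast card_lt_kthSmallest R hk hk'
  have h6 : ((Finset.univ.filter fun i => kthSmallest R k < R i).card : ℝ) + k ≤ N := by
    exact_mod_cast card_kthSmallest_lt R hk hk'
  have h1' : 0 < 1 - α₀ := by linarith
  refine max_le ?_ ?_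
  · calc _ ≤ ((1 - α₀) * N + b) / (1 - α₀) := by gcongr; linarith
      _ = N + b * (1 / (1 - α₀)) := by field_simp
      _ ≤ _ := by gcongr; exact le_max_left _ _
  · calc _ ≤ (α₀ * N + b) / α₀ := by gcongr; linarith
      _ = N + b * (1 / α₀) := by field_simp
      _ ≤ _ := by gcongr; exact le_max_right _ _

/-- The rank-based grid contains a threshold of nearly minimal penalty. -/
lemma IsRankGrid.exists_dpqPenalty_le {n M B : ℕ} {r : Fin M → ℕ} (hr : IsRankGrid n M B r)
    (hn : 0 < n) {α₀ : ℝ} (h0 : 0 < α₀) (h1 : α₀ < 1) (R : Fin n → ℝ) :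
    ∃ i, dpqPenalty α₀ R (rankGrid r R i) ≤ n + B * dpqSensitivity α₀ := by
  have hn' : (0 : ℝ) < n := by exact_mod_cast hn
  have hpos : 0 < (1 - α₀) * (n : ℝ) := mul_pos (by linarith) hn'
  obtain ⟨i, hi⟩ := hr.2 ⌈(1 - α₀) * (n : ℝ)⌉₊ (Nat.ceil_pos.2 hpos)
    (Nat.ceil_le.2 (by nlinarith))
  have hi' : |((r i : ℕ) : ℝ) - (⌈(1 - α₀) * (n : ℝ)⌉₊ : ℕ)| ≤ B := by exact_mod_cast hi
  have h3 := Nat.le_ceil ((1 - α₀) * (n : ℝ))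
  have h4 := Nat.ceil_lt_add_one hpos.le
  have h5 := abs_le.1 hi'
  exact ⟨i, dpqPenalty_kthSmallest_le h0 h1 R (hr.1 i).1 (hr.1 i).2
    (by linarith) (by linarith) B.cast_nonneg⟩

lemma card_le_of_dpqPenalty_le {α₀ S : ℝ} (h0 : 0 < α₀) (h1 : α₀ < 1) (hS : 0 ≤ S) {N : ℕ}
    {R : Fin N → ℝ} {e : ℝ} (h : dpqPenalty α₀ R e ≤ N + S) :
    ((Finset.univ.filter fun i => R i < e).card : ℝ) ≤ N * (1 - α₀) + S ∧
      ((Finset.univ.filter fun i => e < R i).card : ℝ) ≤ N * α₀ + S := by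
  have h1' : 0 < 1 - α₀ := by linarith
  have ha := (le_max_left _ _).trans h
  have hb := (le_max_right _ _).trans h
  rw [div_le_iff₀ h1'] at ha
  rw [div_le_iff₀ h0] at hb
  constructor <;> nlinarith

/-- An index drawn from the conditional probabilities `f` is one of conditional probability at most
`s` with probability at most `M s`. No measurability of `f` is needed, because the conditional
expectation serves as a measurable version of it. -/
lemma measureReal_selectionProb_le {Ω : Type*} {m mΩ : MeasurableSpace Ω} (hm : m ≤ mΩ)
    {Prob : Measure Ω} [IsProbabilityMeasure Prob] {M : ℕ} {J : Ω → Fin M} (hJ : Measurable J)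
    {f : Fin M → Ω → ℝ} (hf : ∀ j, Prob⟦J ⁻¹' {j} | m⟧ =ᵐ[Prob] f j) {s : ℝ} (hs : 0 ≤ s) :
    Prob.real {ω | f (J ω) ω ≤ s} ≤ M * s := by
  have hone : ∀ j, Prob.real {ω | J ω = j ∧ f j ω ≤ s} ≤ s := by
    intro j
    set g := Prob⟦J ⁻¹' {j} | m⟧ with hg
    have hJj : MeasurableSet[mΩ] (J ⁻¹' {j}) := hJ (measurableSet_singleton j)
    have hE : MeasurableSet[m] {ω | g ω ≤ s} :=
      measurableSet_le stronglyMeasurable_condExp.measurable measurable_const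
    have hae : ({ω | J ω = j ∧ f j ω ≤ s} : Set Ω) =ᵐ[Prob]
        (J ⁻¹' {j} ∩ {ω | g ω ≤ s} : Set Ω) := by
      filter_upwards [hf j] with ω hω
      refine propext ?_
      change (J ω = j ∧ f j ω ≤ s) ↔ (J ω = j ∧ g ω ≤ s)
      rw [← hω]
    rw [measureReal_congr hae]
    have hint : Integrable ((J ⁻¹' {j}).indicator fun _ => (1 : ℝ)) Prob :=
      (integrable_const _).indicator hJj
    calc Prob.real (J ⁻¹' {j} ∩ {ω | g ω ≤ s})
        = ∫ ω in {ω | g ω ≤ s}, (J ⁻¹' {j}).indicator (fun _ => (1 : ℝ)) ω ∂Prob := by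
          rw [integral_indicator hJj]
          simp [Measure.restrict_restrict hJj]
      _ = ∫ ω in {ω | g ω ≤ s}, g ω ∂Prob := (setIntegral_condExp hm hint hE).symm
      _ ≤ ∫ ω in {ω | g ω ≤ s}, s ∂Prob :=
          setIntegral_mono_on integrable_condExp.integrableOn (integrable_const _).integrableOn
            (hm _ hE) fun ω hω => hω
      _ ≤ s := by
          rw [setIntegral_const, smul_eq_mul]
          exact mul_le_of_le_one_left hs measureReal_le_one
  calc Prob.real {ω | f (J ω) ω ≤ s}
      ≤ Prob.real (⋃ j, {ω | J ω = j ∧ f j ω ≤ s}) :=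
        measureReal_mono fun ω hω => Set.mem_iUnion.2 ⟨J ω, rfl, hω⟩
    _ ≤ ∑ j, Prob.real {ω | J ω = j ∧ f j ω ≤ s} := measureReal_iUnion_fintype_le _
    _ ≤ ∑ _j : Fin M, s := Finset.sum_le_sum fun j _ => hone j
    _ = M * s := by simp

/-- With probability at least `1 - M exp (-ε s / (2 Δ))` the selected threshold has penalty at most
`n + B Δ + s`. -/
lemma measureReal_dpqPenalty_gt_le {Ω : Type*} {m mΩ : MeasurableSpace Ω} (hm : m ≤ mΩ)
    {Prob : Measure Ω} [IsProbabilityMeasure Prob] {n M B : ℕ} {J : Ω → Fin M} (hJ : Measurable J)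
    {β ε s : ℝ} {r : Fin M → ℕ} (hr : IsRankGrid n M B r) (hn : 0 < n) (hε : 0 < ε)
    (h0 : 0 < alphaZero β n ε) (h1 : alphaZero β n ε < 1) {R : Ω → Fin n → ℝ}
    (hf : ∀ j, Prob⟦J ⁻¹' {j} | m⟧ =ᵐ[Prob] fun ω => dpqProb β ε (R ω) (rankGrid r (R ω)) j) :
    Prob.real {ω | n + B * dpqSensitivity (alphaZero β n ε) + s <
        dpqPenalty (alphaZero β n ε) (R ω) (rankGrid r (R ω) (J ω))} ≤
      M * Real.exp (-(ε * s / (2 * dpqSensitivity (alphaZero β n ε)))) := by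
  refine (measureReal_mono fun ω hω => ?_).trans
    (measureReal_selectionProb_le hm hJ hf (Real.exp_pos _).le)
  obtain ⟨i, hi⟩ := hr.exists_dpqPenalty_le hn h0 h1 (R ω)
  refine dpqProb_le _ _ i _ hε h0 ?_
  rw [Set.mem_ofPred_eq] at hω
  linarith

/-! ### Stability of the minimizer and size of the noise -/

/-- Adding one Lipschitz term to a strongly convex objective moves its minimizer little. -/
lemma norm_est_sub_le {E : Type*} [NormedAddCommGroup E] [NormedSpace ℝ E] {f g : E → ℝ}
    {lam κ : ℝ} (hlam : 0 < lam) (hκ : 0 ≤ κ) (hf : StrongConvexOn Set.univ lam f)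
    (hg : ∀ x y, |g x - g y| ≤ κ * ‖x - y‖) {a b : E} (ha : IsMinOn f Set.univ a)
    (hb : IsMinOn (fun x => f x + g x) Set.univ b) : ‖b - a‖ ≤ 4 * κ / lam := by
  obtain ⟨-, hconv⟩ := hf
  have h1 := hconv (Set.mem_univ b) (Set.mem_univ a) (a := 1 / 2) (b := 1 / 2) (by norm_num)
    (by norm_num) (by norm_num)
  have h2 := isMinOn_univ_iff.1 ha ((1 / 2 : ℝ) • b + (1 / 2 : ℝ) • a)
  have h3 := isMinOn_univ_iff.1 hb a
  have h4 := (abs_le.1 (hg b a)).1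
  simp only [smul_eq_mul] at h1
  rw [le_div_iff₀ hlam]
  have h5 : (lam * ‖b - a‖) * ‖b - a‖ ≤ (4 * κ) * ‖b - a‖ := by nlinarith
  rcases (norm_nonneg (b - a)).eq_or_lt with h0 | h0
  · rw [← h0]; linarith
  · linarith [le_of_mul_le_mul_right h5 h0]

/-- A Gaussian vector with independent coordinates of variance `v` has a sub-Gaussian norm. -/
lemma measureReal_multivariateGaussian_norm_ge_le (d : ℕ) {v w : ℝ} (hv : 0 ≤ v) (hvw : v ≤ w)
    (hw : 0 < w) {s : ℝ} (hs : 0 < s) :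
    (multivariateGaussian 0 (v • (1 : Matrix (Fin d) (Fin d) ℝ))).real {z | s < ‖z‖} ≤
      2 * d * Real.exp (-(s ^ 2 / (2 * (d + 1) * w))) := by
  set G := multivariateGaussian 0 (v • (1 : Matrix (Fin d) (Fin d) ℝ)) with hG
  have hd : (0 : ℝ) < d + 1 := by positivity
  have hpos : (v • (1 : Matrix (Fin d) (Fin d) ℝ)).PosSemidef := Matrix.PosSemidef.one.smul hv
  set c := s / Real.sqrt (d + 1) with hc
  have hc0 : 0 < c := by positivity
  have hsub : ∀ i : Fin d, HasSubgaussianMGF (fun z : EuclideanSpace ℝ (Fin d) => z i)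
      w.toNNReal G := by
    intro i
    have hmp := measurePreserving_eval_multivariateGaussian (μ := 0) hpos (i := i)
    rw [← HasSubgaussianMGF.id_map_iff hmp.measurable.aemeasurable, hmp.map_eq]
    refine ⟨fun t => integrable_exp_mul_gaussianReal t, fun t => ?_⟩
    rw [mgf_id_gaussianReal]
    simp only [Matrix.smul_apply, Matrix.one_apply_eq, smul_eq_mul, mul_one, PiLp.zero_apply,
      zero_mul, zero_add, Real.exp_le_exp, Real.coe_toNNReal v hv, Real.coe_toNNReal w hw.le]
    gcongr
  have hexp : -c ^ 2 / (2 * (w.toNNReal : ℝ)) = -(s ^ 2 / (2 * (d + 1) * w)) := by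
    rw [Real.coe_toNNReal w hw.le, hc, div_pow, Real.sq_sqrt hd.le]
    field_simp
  have hone : ∀ i : Fin d, G.real {z | c ≤ |z i|} ≤
      2 * Real.exp (-(s ^ 2 / (2 * (d + 1) * w))) := by
    intro i
    have h1 := (hsub i).measure_ge_le hc0.le
    have h2 := (hsub i).neg.measure_ge_le hc0.le
    rw [hexp] at h1 h2
    refine (measureReal_mono fun z hz => ?_).trans ((measureReal_union_le _ _).trans
      ((add_le_add h1 h2).trans_eq (two_mul _).symm))
    rw [Set.mem_ofPred_eq] at hz
    exact le_abs.1 hz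
  calc G.real {z | s < ‖z‖} ≤ G.real (⋃ i, {z | c ≤ |z i|}) := by
        refine measureReal_mono fun z hz => ?_
        by_contra hcon
        simp only [Set.mem_iUnion, Set.mem_ofPred_eq, not_exists, not_le] at hcon hz
        have hsq : ‖z‖ ^ 2 ≤ d * c ^ 2 := by
          rw [EuclideanSpace.real_norm_sq_eq]
          calc ∑ i, z i ^ 2 ≤ ∑ _i : Fin d, c ^ 2 :=
                Finset.sum_le_sum fun i _ => sq_le_sq' (by linarith [(abs_lt.1 (hcon i)).1])
                  (abs_lt.1 (hcon i)).2.le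
            _ = d * c ^ 2 := by simp
        have hcs : (d + 1) * c ^ 2 = s ^ 2 := by
          rw [hc, div_pow, Real.sq_sqrt hd.le]; field_simp
        nlinarith [sq_nonneg c]
    _ ≤ ∑ i, G.real {z | c ≤ |z i|} := measureReal_iUnion_fintype_le _
    _ ≤ ∑ _i : Fin d, 2 * Real.exp (-(s ^ 2 / (2 * (d + 1) * w))) :=
        Finset.sum_le_sum fun i _ => hone i
    _ = _ := by simp; ring

/-! ### Symmetric difference of two intervals -/

lemma volume_symmDiff_Icc_le (c₁ c₂ q₁ q₂ : ℝ) :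
    volume (symmDiff (Set.Icc (c₁ - q₁) (c₁ + q₁)) (Set.Icc (c₂ - q₂) (c₂ + q₂))) ≤
      ENNReal.ofReal (2 * |c₁ - c₂| + 2 * |q₁ - q₂|) := by
  have hsub : symmDiff (Set.Icc (c₁ - q₁) (c₁ + q₁)) (Set.Icc (c₂ - q₂) (c₂ + q₂)) ⊆
      Set.uIcc (c₁ - q₁) (c₂ - q₂) ∪ Set.uIcc (c₁ + q₁) (c₂ + q₂) := by
    intro x hx
    simp only [Set.mem_symmDiff, Set.mem_union, Set.mem_Icc, Set.mem_uIcc] at hx ⊢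
    grind
  have e1 := abs_add_le (c₁ - c₂) (q₁ - q₂)
  have e2 := abs_sub (c₁ - c₂) (q₁ - q₂)
  refine (measure_mono hsub).trans ((measure_union_le _ _).trans ?_)
  rw [Real.volume_interval, Real.volume_interval, ← ENNReal.ofReal_add (abs_nonneg _) (abs_nonneg _)]
  refine ENNReal.ofReal_le_ofReal ?_
  rw [show c₂ - q₂ - (c₁ - q₁) = -((c₁ - c₂) - (q₁ - q₂)) by ring,
    show c₂ + q₂ - (c₁ + q₁) = -((c₁ - c₂) + (q₁ - q₂)) by ring, abs_neg, abs_neg]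
  linarith

/-! ### Rates -/

/-- The rate `n^{-η} + log n / n^{1-η}`: the order of the discrepancy, in level, between the
threshold chosen by the private quantile mechanism and the `1 - α` quantile. -/
noncomputable def rate (η : ℝ) (n : ℕ) : ℝ := (n : ℝ) ^ (-η) + Real.log n / (n : ℝ) ^ (1 - η)

section

variable {η : ℝ} {n : ℕ}

lemma log_pos_of_two_le (hn : 2 ≤ n) : 0 < Real.log n :=
  Real.log_pos (by exact_mod_cast hn)

lemma rate_pos (hn : 2 ≤ n) : 0 < rate η n := by
  have hn0 : (0 : ℝ) < n := by exact_mod_cast (by omega : 0 < n)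
  have := log_pos_of_two_le hn
  unfold rate
  positivity

lemma inv_le_rpow_neg (hη' : η ≤ 1) (hn : 2 ≤ n) : (n : ℝ)⁻¹ ≤ (n : ℝ) ^ (-η) := by
  rw [← Real.rpow_neg_one]
  exact Real.rpow_le_rpow_of_exponent_le (by exact_mod_cast (by omega : 1 ≤ n)) (by linarith)

lemma rpow_neg_le_rate (hn : 2 ≤ n) : (n : ℝ) ^ (-η) ≤ rate η n := by
  have := log_pos_of_two_le hn
  unfold rate
  have : 0 ≤ Real.log n / (n : ℝ) ^ (1 - η) := by positivity
  linarith

lemma log_div_le_rate : Real.log n / (n : ℝ) ^ (1 - η) ≤ rate η n := by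
  unfold rate
  have : 0 ≤ (n : ℝ) ^ (-η) := by positivity
  linarith

lemma inv_le_rate_rpow (hη' : η ≤ 1) (hn : 2 ≤ n) {γ : ℝ} (hγ : 0 < γ) (hγ' : γ ≤ 1) :
    (n : ℝ)⁻¹ ≤ rate η n ^ γ := by
  have hn1 : (1 : ℝ) ≤ n := by exact_mod_cast (by omega : 1 ≤ n)
  have h0 : (0 : ℝ) < (n : ℝ)⁻¹ := by positivity
  calc (n : ℝ)⁻¹ = (n : ℝ)⁻¹ ^ (1 : ℝ) := (Real.rpow_one _).symm
    _ ≤ (n : ℝ)⁻¹ ^ γ := Real.rpow_le_rpow_of_exponent_ge h0 (inv_le_one_of_one_le₀ hn1) hγ'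
    _ ≤ rate η n ^ γ := Real.rpow_le_rpow h0.le
        ((inv_le_rpow_neg hη' hn).trans (rpow_neg_le_rate hn)) hγ.le

lemma rpow_neg_mul_rpow (hn : 2 ≤ n) : (n : ℝ) ^ (-η) * n = (n : ℝ) ^ (1 - η) := by
  have hn0 : (0 : ℝ) < n := by exact_mod_cast (by omega : 0 < n)
  rw [← Real.rpow_add_one hn0.ne']
  ring_nf

/-- The two terms of the rate multiply to `log n / n`, so that the rate exceeds
`2 (log n / n) ^ (1 / 2)` whatever the value of `η`, and deviations of this order have
polynomially small Hoeffding bounds. -/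
lemma exp_neg_rate_sq_le (hn : 2 ≤ n) {N : ℕ} (hN : n ≤ N) :
    Real.exp (-(2 * N * rate η n ^ 2)) ≤ (n : ℝ)⁻¹ := by
  have hn0 : (0 : ℝ) < n := by exact_mod_cast (by omega : 0 < n)
  have hN' : (n : ℝ) ≤ N := by exact_mod_cast hN
  have hlog := log_pos_of_two_le hn
  have hp : (0 : ℝ) < (n : ℝ) ^ (1 - η) := by positivity
  have hprod : (n : ℝ) * ((n : ℝ) ^ (-η) * (Real.log n / (n : ℝ) ^ (1 - η))) = Real.log n := by
    rw [← rpow_neg_mul_rpow hn]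
    have : (n : ℝ) ^ (-η) ≠ 0 := by positivity
    field_simp
  have hsq : 4 * ((n : ℝ) ^ (-η) * (Real.log n / (n : ℝ) ^ (1 - η))) ≤ rate η n ^ 2 := by
    unfold rate
    nlinarith [sq_nonneg ((n : ℝ) ^ (-η) - Real.log n / (n : ℝ) ^ (1 - η))]
  have h1 : (n : ℝ) * rate η n ^ 2 ≤ N * rate η n ^ 2 := by gcongr
  have h2 : 4 * Real.log n ≤ n * rate η n ^ 2 := by
    calc 4 * Real.log n = n * (4 * ((n : ℝ) ^ (-η) * (Real.log n / (n : ℝ) ^ (1 - η)))) := by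
          rw [← mul_assoc, mul_comm (n : ℝ) 4, mul_assoc, hprod]
      _ ≤ _ := by gcongr
  rw [← Real.exp_log (inv_pos.2 hn0), Real.log_inv, Real.exp_le_exp]
  linarith

lemma tendsto_rate (hη : 0 < η) (hη' : η < 1) :
    Filter.Tendsto (rate η) Filter.atTop (nhds 0) := by
  have h1 := (tendsto_rpow_neg_atTop hη).comp tendsto_natCast_atTop_atTop
  have h2 := (isLittleO_log_rpow_atTop (sub_pos.2 hη')).tendsto_div_nhds_zero.comp
    tendsto_natCast_atTop_atTop
  have := h1.add h2
  rwa [add_zero] at this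

/-- The level `α₀` at which the private quantile mechanism operates differs from `α` by at most a
multiple of the rate. -/
lemma sub_alphaZero_le {α ε δ cε Cε Cδ : ℝ} (hα : 0 < α) (hα' : α < 1) (hη' : η ≤ 1) (hn : 2 ≤ n)
    (hcε : 0 < cε) (h1 : cε * (n : ℝ) ^ (-η) ≤ ε) (h2 : ε ≤ Cε * (n : ℝ) ^ (-η))
    (hδ : 0 < δ) (h3 : δ ≤ Cδ / n) :
    α - alphaZero (alphaOne α (ε / 2) δ) n (ε / 2) ≤
      (|Cε| + |Cδ| + 4 / (cε * Real.log 2)) * rate η n := by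
  have hn0 : (0 : ℝ) < n := by exact_mod_cast (by omega : 0 < n)
  have hp : (0 : ℝ) < (n : ℝ) ^ (-η) := by positivity
  have hp' : (0 : ℝ) < (n : ℝ) ^ (1 - η) := by positivity
  have hε : 0 < ε := lt_of_lt_of_le (by positivity) h1
  have hlog2 : 0 < Real.log 2 := Real.log_pos (by norm_num)
  have hlog : Real.log 2 ≤ Real.log n := Real.log_le_log (by norm_num) (by exact_mod_cast hn)
  have hu := rate_pos (η := η) hn
  have e1 : ε ≤ |Cε| * rate η n :=
    h2.trans (mul_le_mul (le_abs_self _) (rpow_neg_le_rate hn) hp.le (abs_nonneg _))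
  have e2 : δ ≤ |Cδ| * rate η n := by
    rw [div_eq_mul_inv] at h3
    exact h3.trans (mul_le_mul (le_abs_self _)
      ((inv_le_rpow_neg hη' hn).trans (rpow_neg_le_rate hn)) (by positivity) (abs_nonneg _))
  have e3 : 2 / (n * (ε / 2)) ≤ 4 / (cε * Real.log 2) * rate η n := by
    calc 2 / (n * (ε / 2)) ≤ 2 / (n * (cε * (n : ℝ) ^ (-η) / 2)) := by gcongr
      _ = 4 / (cε * Real.log 2) * (Real.log 2 / (n : ℝ) ^ (1 - η)) := by
          rw [← rpow_neg_mul_rpow hn]; field_simp; norm_num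
      _ ≤ 4 / (cε * Real.log 2) * rate η n := by
          gcongr
          exact le_trans (by gcongr) log_div_le_rate
  have e4 : α - alphaOne α (ε / 2) δ ≤ ε + δ := by
    have h5 := Real.add_one_le_exp (-(ε / 2))
    have h6 : Real.exp (-(ε / 2)) ≤ 1 := Real.exp_le_one_iff.2 (by linarith)
    unfold alphaOne
    nlinarith
  unfold alphaZero
  linarith

lemma alphaZero_le {α ε δ : ℝ} (hε : 0 < ε) (hδ : 0 < δ) (hδα : δ < α) (n : ℕ) :
    alphaZero (alphaOne α (ε / 2) δ) n (ε / 2) ≤ α := by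
  have h6 : Real.exp (-(ε / 2)) ≤ 1 := Real.exp_le_one_iff.2 (by linarith)
  have h7 : 0 ≤ 2 / (n * (ε / 2)) := by positivity
  unfold alphaZero alphaOne
  nlinarith

/-- The private quantile mechanism loses at most a multiple of `n * rate` ranks: `B Δ` through the
gaps of the grid and `4 Δ log n / (ε / 2)` through the randomness of the selection. -/
lemma rank_loss_le {α α₀ cε ε : ℝ} (B : ℕ) (hα : 0 < α) (hα' : α < 1) (hη' : η ≤ 1) (hn : 2 ≤ n)
    (hcε : 0 < cε) (h1 : cε * (n : ℝ) ^ (-η) ≤ ε) (hα₀ : α / 2 ≤ α₀) (hα₀α : α₀ ≤ α) :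
    B * dpqSensitivity α₀ + 4 * dpqSensitivity α₀ * Real.log n / (ε / 2) ≤
      n * ((B * max (1 / (1 - α)) (2 / α) + 8 * max (1 / (1 - α)) (2 / α) / cε) * rate η n) := by
  have hn0 : (0 : ℝ) < n := by exact_mod_cast (by omega : 0 < n)
  have hlog := log_pos_of_two_le hn
  have hα₀0 : 0 < α₀ := by linarith
  have hΔ0 := dpqSensitivity_pos hα₀0
  have hΔD : dpqSensitivity α₀ ≤ max (1 / (1 - α)) (2 / α) := by
    have h1α : 0 < 1 - α := by linarith
    refine max_le_max (by gcongr) ?_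
    rw [div_le_div_iff₀ hα₀0 hα]
    linarith
  set D : ℝ := max (1 / (1 - α)) (2 / α)
  set Δ := dpqSensitivity α₀
  have hD0 : 0 < D := hΔ0.trans_le hΔD
  have h2 : 1 ≤ n * rate η n := by
    rw [← mul_inv_cancel₀ hn0.ne']
    exact mul_le_mul_of_nonneg_left ((inv_le_rpow_neg hη' hn).trans (rpow_neg_le_rate hn)) hn0.le
  have h3 : 4 * Δ * Real.log n / (ε / 2) ≤ 8 * D / cε * (n * rate η n) := by
    calc 4 * Δ * Real.log n / (ε / 2) ≤ 4 * D * Real.log n / (cε * (n : ℝ) ^ (-η) / 2) := by gcongr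
      _ = 8 * D / cε * (n * (Real.log n / (n : ℝ) ^ (1 - η))) := by
        rw [← rpow_neg_mul_rpow hn]
        field_simp
        norm_num
      _ ≤ 8 * D / cε * (n * rate η n) := by
        gcongr
        exact log_div_le_rate
  have h4 : B * Δ ≤ B * D * (n * rate η n) :=
    (mul_le_mul_of_nonneg_left hΔD B.cast_nonneg).trans
      (le_mul_of_one_le_right (by positivity) h2)
  linarith

/-- The variance of the noise is of order `log n / n ^ (2 - 2 η)`. -/
lemma noiseVariance_le {ρ L lam cε ε δ K : ℝ} (hn : 2 ≤ n)
    (hcε : 0 < cε) (h1 : cε * (n : ℝ) ^ (-η) ≤ ε) (hδ : (n : ℝ) ^ (-K) ≤ δ) :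
    noiseVariance ρ L lam n (ε / 2) δ ≤
      (8 * (|K| + 1) * (2 * (ρ * L) / lam) ^ 2 / cε ^ 2) *
        (Real.log n / (n : ℝ) ^ (2 - 2 * η)) := by
  have hn0 : (0 : ℝ) < n := by exact_mod_cast (by omega : 0 < n)
  have hn2 : (2 : ℝ) ≤ n := by exact_mod_cast hn
  have hp : (0 : ℝ) < (n : ℝ) ^ (-η) := by positivity
  have hlog := log_pos_of_two_le hn
  have hδ0 : 0 < δ := lt_of_lt_of_le (by positivity) hδ
  have hlogδ : Real.log (1.25 / δ) ≤ (|K| + 1) * Real.log n := by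
    have e1 : Real.log (1.25 / δ) ≤ Real.log (n * (n : ℝ) ^ K) := by
      refine Real.log_le_log (by positivity) ?_
      rw [div_le_iff₀ hδ0]
      calc (1.25 : ℝ) ≤ n * 1 := by linarith
        _ = n * ((n : ℝ) ^ K * (n : ℝ) ^ (-K)) := by
            rw [← Real.rpow_add hn0, add_neg_cancel, Real.rpow_zero]
        _ ≤ n * ((n : ℝ) ^ K * δ) := by gcongr
        _ = n * (n : ℝ) ^ K * δ := by ring
    rw [Real.log_mul hn0.ne' (by positivity), Real.log_rpow hn0] at e1
    nlinarith [le_abs_self K]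
  have hpow : (n : ℝ) ^ (2 - 2 * η) = ((n : ℝ) ^ (-η) * n) ^ 2 := by
    rw [rpow_neg_mul_rpow hn, ← Real.rpow_natCast, ← Real.rpow_mul hn0.le]
    congr 1
    push_cast
    ring
  calc noiseVariance ρ L lam n (ε / 2) δ
      ≤ 2 * ((|K| + 1) * Real.log n) * tau ρ L lam n ^ 2 / (cε * (n : ℝ) ^ (-η) / 2) ^ 2 := by
        unfold noiseVariance
        gcongr
    _ = _ := by
        rw [hpow, tau]
        field_simp
        ring

/-- Gaussian tail of the noise. -/
lemma measureReal_noiseLaw_norm_gt_le (d : ℕ) {ρ L lam cε ε δ K t V : ℝ} (hn : 2 ≤ n)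
    (hcε : 0 < cε) (h1 : cε * (n : ℝ) ^ (-η) ≤ ε) (hδ : (n : ℝ) ^ (-K) ≤ δ) (hδ1 : δ ≤ 1)
    (hV : 8 * (|K| + 1) * (2 * (ρ * L) / lam) ^ 2 / cε ^ 2 ≤ V) (hV0 : 0 < V) (ht : 0 < t) :
    (noiseLaw d ρ L lam n (ε / 2) δ).real {z | (2 * (d + 1) * V + 1) * t < ‖z‖} ≤
      2 * d * Real.exp (-((n : ℝ) ^ (2 - 2 * η) * t ^ 2 / Real.log n)) := by
  have hn0 : (0 : ℝ) < n := by exact_mod_cast (by omega : 0 < n)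
  have hlog := log_pos_of_two_le hn
  have hp : (0 : ℝ) < (n : ℝ) ^ (2 - 2 * η) := by positivity
  have hδ0 : 0 < δ := lt_of_lt_of_le (by positivity) hδ
  have hv0 : 0 ≤ noiseVariance ρ L lam n (ε / 2) δ := by
    have : 0 ≤ Real.log (1.25 / δ) := Real.log_nonneg (by rw [le_div_iff₀ hδ0]; linarith)
    unfold noiseVariance
    positivity
  have hw : noiseVariance ρ L lam n (ε / 2) δ ≤ V * (Real.log n / (n : ℝ) ^ (2 - 2 * η)) :=
    (noiseVariance_le hn hcε h1 hδ).trans (by gcongr)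
  refine (measureReal_multivariateGaussian_norm_ge_le d hv0 hw (by positivity)
    (s := (2 * (d + 1) * V + 1) * t) (by positivity)).trans ?_
  refine mul_le_mul_of_nonneg_left (Real.exp_le_exp.2 (neg_le_neg ?_)) (by positivity)
  have hd : (0 : ℝ) < 2 * (d + 1) * V := by positivity
  have hT : 1 ≤ (2 * (d + 1) * V + 1) ^ 2 / (2 * (d + 1) * V) := by
    rw [le_div_iff₀ hd]; nlinarith
  calc (n : ℝ) ^ (2 - 2 * η) * t ^ 2 / Real.log n
      ≤ (2 * (d + 1) * V + 1) ^ 2 / (2 * (d + 1) * V) *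
          ((n : ℝ) ^ (2 - 2 * η) * t ^ 2 / Real.log n) :=
        le_mul_of_one_le_left (by positivity) hT
    _ = _ := by
        generalize (n : ℝ) ^ (2 - 2 * η) = x at hp ⊢
        field_simp

end

/-! ### The event on which the two intervals are close -/

section

variable {𝒳 : Type*} {𝒴 : Set ℝ} {d n M : ℕ}

lemma measurable_score [MeasurableSpace 𝒳] {μ : 𝒳 → EuclideanSpace ℝ (Fin d) → ℝ}
    (hμ : Measurable (Function.uncurry μ)) {Ω : Type*} [MeasurableSpace Ω]
    {θ : Ω → EuclideanSpace ℝ (Fin d)} (hθ : Measurable θ) {z : Ω → 𝒳 × 𝒴} (hz : Measurable z) :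
    Measurable fun ω => score μ (θ ω) (z ω) :=
  (((measurable_subtype_coe.comp (measurable_snd.comp hz))).sub
    (hμ.comp ((measurable_fst.comp hz).prodMk hθ))).abs

lemma measurable_privScores [MeasurableSpace 𝒳] {μ : 𝒳 → EuclideanSpace ℝ (Fin d) → ℝ}
    (hμ : Measurable (Function.uncurry μ)) {est : (Fin n → 𝒳 × 𝒴) → EuclideanSpace ℝ (Fin d)}
    (hest : Measurable est) {Ω : Type*} [MeasurableSpace Ω] {Z : Ω → Fin (n + 1) → 𝒳 × 𝒴}
    (hZ : Measurable Z) {ζ : Ω → EuclideanSpace ℝ (Fin d)} (hζ : Measurable ζ) :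
    Measurable fun ω => privScores μ est (Z ω) (ζ ω) := by
  have hinit : Measurable fun ω => (Fin.init (Z ω) : Fin n → 𝒳 × 𝒴) :=
    measurable_pi_lambda _ fun i => (measurable_pi_apply i.castSucc).comp hZ
  exact measurable_pi_lambda _ fun i => measurable_score hμ ((hest.comp hinit).add hζ)
    ((measurable_pi_apply _).comp hZ)

lemma measurable_oracleScores [MeasurableSpace 𝒳] {μ : 𝒳 → EuclideanSpace ℝ (Fin d) → ℝ}
    (hμ : Measurable (Function.uncurry μ))
    {estAug : (Fin (n + 1) → 𝒳 × 𝒴) → EuclideanSpace ℝ (Fin d)} (hest : Measurable estAug)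
    {Ω : Type*} [MeasurableSpace Ω] {Z : Ω → Fin (n + 1) → 𝒳 × 𝒴} (hZ : Measurable Z) :
    Measurable fun ω => oracleScores μ estAug (Z ω) :=
  measurable_pi_lambda _ fun i => measurable_score hμ (hest.comp hZ)
    ((measurable_pi_apply i).comp hZ)

/-- Leaving out the last observation moves the empirical risk minimizer by `O(1 / n)`. -/
lemma norm_estAug_sub_est_le {ℓ : ℝ → ℝ → ℝ} {μ : 𝒳 → EuclideanSpace ℝ (Fin d) → ℝ}
    {reg : EuclideanSpace ℝ (Fin d) → ℝ} {ρ L lam : ℝ} (hρ : 0 ≤ ρ) (hL : 0 ≤ L) (hlam : 0 < lam)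
    (hℓ : ∀ x, ∀ y ∈ 𝒴, ∀ ϑ ϑ', |ℓ y (μ x ϑ) - ℓ y (μ x ϑ')| ≤ ρ * L * ‖ϑ - ϑ'‖)
    (hJ : ∀ D : Fin n → 𝒳 × 𝒴, StrongConvexOn Set.univ lam (objective ℓ μ reg D))
    {est : (Fin n → 𝒳 × 𝒴) → EuclideanSpace ℝ (Fin d)}
    {estAug : (Fin (n + 1) → 𝒳 × 𝒴) → EuclideanSpace ℝ (Fin d)}
    (hest : ∀ D, IsMinOn (objective ℓ μ reg D) Set.univ (est D))
    (hestAug : ∀ D, IsMinOn (augObjective ℓ μ reg D) Set.univ (estAug D))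
    (D : Fin (n + 1) → 𝒳 × 𝒴) :
    ‖estAug D - est (Fin.init D)‖ ≤ 4 * (ρ * L) / lam * (n : ℝ)⁻¹ := by
  have hn : (0 : ℝ) ≤ 1 / n := by positivity
  refine (norm_est_sub_le (κ := 1 / n * (ρ * L)) (g := fun ϑ =>
    (1 / n) * ℓ ((D (Fin.last n)).2 : ℝ) (μ (D (Fin.last n)).1 ϑ)) hlam (by positivity)
    (hJ (Fin.init D)) (fun x y => ?_) (hest _) (hestAug D)).trans_eq (by ring)
  rw [← mul_sub, abs_mul, abs_of_nonneg hn, mul_assoc]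
  exact mul_le_mul_of_nonneg_left (hℓ _ _ (D (Fin.last n)).2.2 _ _) hn

/-- Deterministic comparison of the two intervals: if both score vectors are typical and the
selected threshold has small penalty, both radii lie between the quantiles of `ν` at the levels
`1 - α ± a`; the centres differ by the shift of the minimizer and the noise. -/
lemma volume_symmDiff_intervals_le {μ : 𝒳 → EuclideanSpace ℝ (Fin d) → ℝ} {L : ℝ} (hL : 0 ≤ L)
    (hμL : ∀ x ϑ ϑ', |μ x ϑ - μ x ϑ'| ≤ L * ‖ϑ - ϑ'‖)
    {est : (Fin n → 𝒳 × 𝒴) → EuclideanSpace ℝ (Fin d)}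
    {estAug : (Fin (n + 1) → 𝒳 × 𝒴) → EuclideanSpace ℝ (Fin d)} {α α₀ a u S κ s : ℝ}
    (hα : 0 < α) (hα' : α < 1) (hα₀ : 0 < α₀) (hα₀α : α₀ ≤ α) (hS : 0 ≤ S) (hua : u ≤ a)
    (hlev : n * (α - α₀) + S ≤ n * (a - u)) {ν : Measure ℝ} {r : Fin M → ℕ}
    {D : Fin (n + 1) → 𝒳 × 𝒴} {z : EuclideanSpace ℝ (Fin d)} {j : Fin M}
    (hκ : ‖estAug D - est (Fin.init D)‖ ≤ κ) (hz : ‖z‖ ≤ s)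
    (hR : privScores μ est D z ∈ typicalSet ν (1 - α - a) (1 - α + a) u n)
    (hR' : oracleScores μ estAug D ∈ typicalSet ν (1 - α - a) (1 - α + a) u (n + 1))
    (hpen : dpqPenalty α₀ (privScores μ est D z) (rankGrid r (privScores μ est D z) j) ≤ n + S) :
    volume (symmDiff (oracleInterval μ estAug α D) (dpcpInterval μ est r D z j)) ≤
      ENNReal.ofReal (2 * (L * (κ + s)) +
        2 * |quantile ν (1 - α + a) - quantile ν (1 - α - a)|) := by
  have ho := kthSmallest_ceil_mem_Icc hα hα' n.succ_pos hua hR'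
  rw [Nat.cast_add_one] at ho
  obtain ⟨hlt, hgt⟩ := card_le_of_dpqPenalty_le hα₀ (by linarith) hS hpen
  have hnα : (0 : ℝ) ≤ n * (α - α₀) := mul_nonneg n.cast_nonneg (by linarith)
  have hp := mem_Icc_quantile_of_mem_typicalSet hR (hlt.trans (by linarith))
    (hgt.trans (by linarith))
  refine (volume_symmDiff_Icc_le _ _ _ _).trans (ENNReal.ofReal_le_ofReal ?_)
  refine add_le_add (mul_le_mul_of_nonneg_left ((hμL _ _ _).trans ?_) zero_le_two)
    (mul_le_mul_of_nonneg_left ?_ zero_le_two)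
  · refine mul_le_mul_of_nonneg_left ?_ hL
    rw [privParam, ← sub_sub]
    exact (norm_sub_le _ _).trans (add_le_add hκ hz)
  · refine le_trans (abs_sub_le_iff.2 ⟨?_, ?_⟩) (le_abs_self _) <;>
      linarith [ho.1, ho.2, hp.1, hp.2]

end

end DPCP

theorem mainTheorem4
    -- fixed constants of the problem; all constants hidden in `O(·)` depend on these only
    (d : ℕ) (α η γ h ε₀ ρ L lam : ℝ)
    (hα : 0 < α) (hα' : α < 1) (hη : 0 < η) (hη' : η < 1)
    (hγ : 0 < γ) (hγ' : γ ≤ 1) (hh : 0 ≤ h)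
    (hε₀ : 0 < ε₀) (hε₀α : ε₀ < α) (hε₀α' : ε₀ < 1 - α)
    (hρ : 0 ≤ ρ) (hL : 0 ≤ L) (hlam : 0 < lam)
    -- the constants in `ε = Θ(n^{-η})`, `n^{-K} ≤ δ = O(n⁻¹)`, `M = O(n)` and of the rank grid
    (cε Cε Cδ K CM : ℝ) (B : ℕ) (hcε : 0 < cε) :
    ∃ C : ℝ, 0 < C ∧
      ∀ (n M : ℕ) (ε δ ξ : ℝ), 2 ≤ n →
      cε * (n : ℝ) ^ (-η) ≤ ε → ε ≤ Cε * (n : ℝ) ^ (-η) →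
      (n : ℝ) ^ (-K) ≤ δ → δ ≤ Cδ / n →
      (M : ℝ) ≤ CM * n →
      -- the input requirement `β > 2 / (N ε₂)` of the private quantile mechanism
      2 / (n * (ε / 2)) < DPCP.alphaOne α (ε / 2) δ →
      -- rank-based grid of candidate thresholds
      ∀ (r : Fin M → ℕ), DPCP.IsRankGrid n M B r →
      -- the learning problem
      ∀ (𝒳 : Type*) [MeasurableSpace 𝒳] (𝒴 : Set ℝ)
        (ℓ : ℝ → ℝ → ℝ) (μ : 𝒳 → EuclideanSpace ℝ (Fin d) → ℝ)
        (reg : EuclideanSpace ℝ (Fin d) → ℝ),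
      Measurable (Function.uncurry μ) →
      (∀ x ϑ ϑ', |μ x ϑ - μ x ϑ'| ≤ L * ‖ϑ - ϑ'‖) →
      (∀ x, ∀ y ∈ 𝒴, ∀ ϑ ϑ', |ℓ y (μ x ϑ) - ℓ y (μ x ϑ')| ≤ ρ * L * ‖ϑ - ϑ'‖) →
      (∀ D : Fin n → 𝒳 × 𝒴, StrongConvexOn Set.univ lam (DPCP.objective ℓ μ reg D)) →
      -- the empirical risk minimizers on `n` and on `n + 1` observations
      ∀ (est : (Fin n → 𝒳 × 𝒴) → EuclideanSpace ℝ (Fin d))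
        (estAug : (Fin (n + 1) → 𝒳 × 𝒴) → EuclideanSpace ℝ (Fin d)),
      Measurable est → Measurable estAug →
      (∀ D, IsMinOn (DPCP.objective ℓ μ reg D) Set.univ (est D)) →
      (∀ D, IsMinOn (DPCP.augObjective ℓ μ reg D) Set.univ (estAug D)) →
      -- i.i.d. data, independent Gaussian noise, and the index selected by the private quantile
      -- mechanism with fresh randomness
      ∀ (P : MeasureTheory.Measure (𝒳 × 𝒴)) [MeasureTheory.IsProbabilityMeasure P]
        (Ω : Type*) [MeasurableSpace Ω] (Prob : MeasureTheory.Measure Ω)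
        [MeasureTheory.IsProbabilityMeasure Prob]
        (Z : Ω → Fin (n + 1) → 𝒳 × 𝒴) (ζ : Ω → EuclideanSpace ℝ (Fin d)) (J : Ω → Fin M),
      Measurable Z → Measurable ζ → Measurable J →
      ProbabilityTheory.iIndepFun (fun i ω => Z ω i) Prob →
      (∀ i, Prob.map (fun ω => Z ω i) = P) →
      ProbabilityTheory.IndepFun Z ζ Prob →
      Prob.map ζ = DPCP.noiseLaw d ρ L lam n (ε / 2) δ →
      (∀ j, Prob⟦J ⁻¹' {j} | MeasurableSpace.comap (fun ω => (Z ω, ζ ω)) inferInstance⟧ =ᵐ[Prob]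
        fun ω => DPCP.dpqProb (DPCP.alphaOne α (ε / 2) δ) (ε / 2)
          (DPCP.privScores μ est (Z ω) (ζ ω))
          (DPCP.rankGrid r (DPCP.privScores μ est (Z ω) (ζ ω))) j) →
      -- the idealized distribution `ν`: Hölder quantile function near `1 - α`, and both score
      -- sequences are `ξ`-approximately i.i.d. with distribution `ν`
      ∀ (ν : MeasureTheory.Measure ℝ) [MeasureTheory.IsProbabilityMeasure ν],
      (∀ q₁ ∈ Set.Icc (1 - α - ε₀) (1 - α + ε₀), ∀ q₂ ∈ Set.Icc (1 - α - ε₀) (1 - α + ε₀),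
        |DPCP.quantile ν q₁ - DPCP.quantile ν q₂| ≤ h * |q₁ - q₂| ^ γ) →
      DPCP.ApproxIID Prob (fun ω => DPCP.privScores μ est (Z ω) (ζ ω)) ν ξ →
      DPCP.ApproxIID Prob (fun ω => DPCP.oracleScores μ estAug (Z ω)) ν ξ →
      ∀ t : ℝ, 0 < t →
        Prob.real {ω | ENNReal.ofReal
              (C * (((n : ℝ) ^ (-η) + Real.log n / (n : ℝ) ^ (1 - η)) ^ γ + t)) <
            MeasureTheory.volume
              (symmDiff (DPCP.oracleInterval μ estAug α (Z ω))
                (DPCP.dpcpInterval μ est r (Z ω) (ζ ω) (J ω)))} ≤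
          C * ((n : ℝ) ^ (-(1 - η)) + 1 / ((n : ℝ) ^ η * Real.log n) +
            Real.exp (-((n : ℝ) ^ (2 - 2 * η) * t ^ 2 / Real.log n))) + 3 * ξ := by
  -- a bound on the sensitivity `Δ`, valid as soon as `α₀ ≥ α / 2`
  set D : ℝ := max (1 / (1 - α)) (2 / α) with hD
  set A₁ : ℝ := |Cε| + |Cδ| + 4 / (cε * Real.log 2) with hA₁
  set A₂ : ℝ := B * D + 8 * D / cε with hA₂
  set A : ℝ := A₁ + A₂ + 1 with hA
  set V : ℝ := 8 * (|K| + 1) * (2 * (ρ * L) / lam) ^ 2 / cε ^ 2 + 1 with hV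
  set T : ℝ := 2 * (d + 1) * V + 1 with hT
  have hlog2 : 0 < Real.log 2 := Real.log_pos (by norm_num)
  have hD0 : 0 < D := lt_max_of_lt_right (by positivity)
  have hA₁0 : 0 ≤ A₁ := by positivity
  have hA₂0 : 0 ≤ A₂ := by positivity
  have hA0 : 0 < A := by positivity
  have hV0 : 0 < V := by positivity
  have hT0 : 0 < T := by positivity
  clear_value D A₁ A₂ A V T
  -- beyond `N₀`, the levels `1 - α ± A * rate` stay in the window of the Hölder condition
  obtain ⟨N₀, hN₀⟩ : ∃ N₀ : ℕ, ∀ n ≥ N₀, A * DPCP.rate η n < min ε₀ (α / 2) := by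
    have h0 : Filter.Tendsto (fun n => A * DPCP.rate η n) Filter.atTop (nhds 0) := by
      simpa using (DPCP.tendsto_rate hη hη').const_mul A
    exact Filter.eventually_atTop.1
      (h0.eventually_lt_const (lt_min hε₀ (by positivity : 0 < α / 2)))
  set C₁ : ℝ := 8 * L * (ρ * L) / lam + 2 * (h * (2 * A) ^ γ) with hC₁
  have hC₁0 : 0 ≤ C₁ := by positivity
  set C : ℝ := N₀ + C₁ + 2 * L * T + (|CM| + 4) + 2 * d with hC
  have hCN : (N₀ : ℝ) ≤ C := by
    rw [hC]; linarith [abs_nonneg CM, (by positivity : 0 ≤ 2 * L * T + 2 * (d : ℝ))]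
  have hCC₁ : C₁ ≤ C := by
    rw [hC]; linarith [abs_nonneg CM, (by positivity : 0 ≤ 2 * L * T + 2 * (d : ℝ) + N₀)]
  have hCT : 2 * L * T ≤ C := by
    rw [hC]; linarith [abs_nonneg CM, (by positivity : 0 ≤ 2 * (d : ℝ) + N₀)]
  have hCM' : |CM| + 4 ≤ C := by
    rw [hC]; linarith [abs_nonneg CM, (by positivity : 0 ≤ 2 * L * T + 2 * (d : ℝ) + N₀)]
  have hCd : 2 * (d : ℝ) ≤ C := by
    rw [hC]; linarith [abs_nonneg CM, (by positivity : 0 ≤ 2 * L * T + (N₀ : ℝ))]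
  clear_value C₁ C
  have hC0 : 0 < C := by linarith [abs_nonneg CM]
  refine ⟨C, hC0, ?_⟩
  intro n M ε δ ξ hn hε1 hε2 hδ1 hδ2 hM hβ r hr 𝒳 _ 𝒴 ℓ μ reg hμ hμL hℓ hJ est estAug hest hestAug
    hmin hminAug P _ Ω _ Prob _ Z ζ J hZ hζ hJm _ _ _ hlaw hsel ν _ hHol happ happ' t ht
  have hn0 : (0 : ℝ) < n := by exact_mod_cast (by omega : 0 < n)
  have hlog := DPCP.log_pos_of_two_le hn
  have hmR := DPCP.measurable_privScores hμ hest hZ hζ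
  have hmR' := DPCP.measurable_oracleScores hμ hestAug hZ
  have hξ : 0 ≤ ξ := happ.nonneg hmR
  have hinv : (n : ℝ)⁻¹ ≤ (n : ℝ) ^ (-(1 - η)) := DPCP.inv_le_rpow_neg (by linarith) hn
  set E : ℝ := Real.exp (-((n : ℝ) ^ (2 - 2 * η) * t ^ 2 / Real.log n))
  have hE0 : 0 < E := Real.exp_pos _
  rcases lt_or_ge n N₀ with hnN | hnN
  · -- for small `n` the right-hand side is at least `1`
    have hle : (n : ℝ) ≤ N₀ := by exact_mod_cast hnN.le
    have h1 : 1 ≤ C * (n : ℝ) ^ (-(1 - η)) := by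
      calc (1 : ℝ) = n * (n : ℝ)⁻¹ := (mul_inv_cancel₀ hn0.ne').symm
        _ ≤ C * (n : ℝ) ^ (-(1 - η)) :=
          mul_le_mul (hle.trans hCN) hinv (by positivity) hC0.le
    refine measureReal_le_one.trans (h1.trans ?_)
    have : 0 ≤ C * (1 / ((n : ℝ) ^ η * Real.log n) + E) := by positivity
    linarith
  set u := DPCP.rate η n
  have hu0 : 0 < u := DPCP.rate_pos hn
  obtain ⟨hAu1, hAu2⟩ := lt_min_iff.1 (hN₀ n hnN)
  have hε : 0 < ε := lt_of_lt_of_le (by positivity) hε1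
  have hδ : 0 < δ := lt_of_lt_of_le (by positivity) hδ1
  have hδα : δ < α := by
    have h1 : 0 < DPCP.alphaOne α (ε / 2) δ := lt_trans (by positivity) hβ
    have h2 := pos_of_mul_pos_right h1 (Real.exp_pos _).le
    linarith
  set α₀ := DPCP.alphaZero (DPCP.alphaOne α (ε / 2) δ) n (ε / 2)
  have hα₀0 : 0 < α₀ := sub_pos.2 hβ
  have hα₀α : α₀ ≤ α := DPCP.alphaZero_le hε hδ hδα n
  have hα₀A : α - α₀ ≤ A₁ * u := by
    rw [hA₁]
    exact DPCP.sub_alphaZero_le hα hα' hη'.le hn hcε hε1 hε2 hδ hδ2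
  have hα₀2 : α / 2 ≤ α₀ := by
    have h1 : A₁ * u ≤ A * u := mul_le_mul_of_nonneg_right (by linarith) hu0.le
    linarith
  set Δ := DPCP.dpqSensitivity α₀
  have hΔ0 : 0 < Δ := DPCP.dpqSensitivity_pos hα₀0
  -- the excess penalty for which the exponential bound equals `n⁻²`
  set s : ℝ := 4 * Δ * Real.log n / (ε / 2) with hs
  have hs0 : 0 ≤ s := by positivity
  have hexp : Real.exp (-(ε / 2 * s / (2 * Δ))) = (n : ℝ)⁻¹ ^ 2 := by
    rw [← Real.exp_log (by positivity : (0 : ℝ) < (n : ℝ)⁻¹), ← Real.exp_nat_mul, Real.log_inv, hs]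
    congr 1
    field_simp
    norm_num
  have hS : B * Δ + s ≤ n * (A₂ * u) := by
    rw [hA₂, hD]
    exact DPCP.rank_loss_le B hα hα' hη'.le hn hcε hε1 hα₀2 hα₀α
  have hlev : n * (α - α₀) + (B * Δ + s) ≤ n * (A * u - u) := by
    have := mul_le_mul_of_nonneg_left hα₀A hn0.le
    have e : n * (A * u - u) = n * (A₁ * u) + n * (A₂ * u) := by rw [hA]; ring
    linarith
  have huA : u ≤ A * u := le_mul_of_one_le_left hu0.le (by rw [hA]; linarith)
  have hquant : |DPCP.quantile ν (1 - α + A * u) - DPCP.quantile ν (1 - α - A * u)| ≤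
      h * (2 * A) ^ γ * u ^ γ := by
    have hAu : 0 < A * u := by positivity
    refine (hHol _ ⟨by linarith, by linarith⟩ _ ⟨by linarith, by linarith⟩).trans_eq ?_
    rw [show 1 - α + A * u - (1 - α - A * u) = 2 * A * u by ring, abs_of_pos (by positivity),
      Real.mul_rpow (by positivity) hu0.le]
    ring
  -- the four exceptional events
  have hb1 := happ.measureReal_notMem_typicalSet_le hmR (p₁ := 1 - α - A * u)
    (p₂ := 1 - α + A * u) (u := u) (by linarith) (by linarith) hu0.le (by omega)
  have hb2 := happ'.measureReal_notMem_typicalSet_le hmR' (p₁ := 1 - α - A * u)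
    (p₂ := 1 - α + A * u) (u := u) (by linarith) (by linarith) hu0.le (by omega)
  have hb3 := DPCP.measureReal_dpqPenalty_gt_le (hZ.prodMk hζ).comap_le hJm (s := s) hr (by omega)
    (by positivity : 0 < ε / 2) hα₀0 (by linarith : α₀ < 1) hsel
  have hb4 : Prob.real {ω | T * t < ‖ζ ω‖} ≤ 2 * d * E := by
    have h1 := DPCP.measureReal_noiseLaw_norm_gt_le d hn hcε hε1 hδ1 (by linarith : δ ≤ 1)
      (by rw [hV]; linarith) hV0 ht (ρ := ρ) (L := L) (lam := lam)
    rw [← hlaw, map_measureReal_apply hζ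
      (measurableSet_lt measurable_const measurable_norm), ← hT] at h1
    exact h1
  rw [hexp] at hb3
  have hexp1 : Real.exp (-(2 * n * u ^ 2)) ≤ (n : ℝ)⁻¹ := DPCP.exp_neg_rate_sq_le hn le_rfl
  have hexp2 : Real.exp (-(2 * (n + 1 : ℕ) * u ^ 2)) ≤ (n : ℝ)⁻¹ :=
    DPCP.exp_neg_rate_sq_le hn (Nat.le_succ n)
  have hMn : M * (n : ℝ)⁻¹ ^ 2 ≤ |CM| * (n : ℝ)⁻¹ := by
    calc M * (n : ℝ)⁻¹ ^ 2 ≤ |CM| * n * (n : ℝ)⁻¹ ^ 2 := by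
          gcongr
          exact hM.trans (mul_le_mul_of_nonneg_right (le_abs_self _) hn0.le)
      _ = |CM| * (n : ℝ)⁻¹ := by field_simp
  refine (measureReal_mono (s₂ := (({ω | DPCP.privScores μ est (Z ω) (ζ ω) ∉
      DPCP.typicalSet ν (1 - α - A * u) (1 - α + A * u) u n} ∪
    {ω | DPCP.oracleScores μ estAug (Z ω) ∉
      DPCP.typicalSet ν (1 - α - A * u) (1 - α + A * u) u (n + 1)}) ∪
    {ω | n + B * Δ + s < DPCP.dpqPenalty α₀ (DPCP.privScores μ est (Z ω) (ζ ω))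
      (DPCP.rankGrid r (DPCP.privScores μ est (Z ω) (ζ ω)) (J ω))}) ∪
    {ω | T * t < ‖ζ ω‖}) fun ω hω => ?_).trans ?_
  · by_contra hcon
    simp only [Set.mem_union, Set.mem_ofPred_eq, not_or, not_not, not_lt] at hcon
    obtain ⟨⟨⟨hc1, hc2⟩, hc3⟩, hc4⟩ := hcon
    rw [Set.mem_ofPred_eq] at hω
    refine absurd hω (not_lt.2 ?_)
    refine (DPCP.volume_symmDiff_intervals_le hL hμL hα hα' hα₀0 hα₀α (by positivity) huA hlev
      (DPCP.norm_estAug_sub_est_le hρ hL hlam hℓ hJ hmin hminAug (Z ω)) hc4 hc1 hc2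
      (by linarith)).trans (ENNReal.ofReal_le_ofReal ?_)
    have huγ : (n : ℝ)⁻¹ ≤ u ^ γ := DPCP.inv_le_rate_rpow hη'.le hn hγ hγ'
    have hcen : 2 * (L * (4 * (ρ * L) / lam * (n : ℝ)⁻¹)) ≤ 8 * L * (ρ * L) / lam * u ^ γ := by
      calc 2 * (L * (4 * (ρ * L) / lam * (n : ℝ)⁻¹)) = 8 * L * (ρ * L) / lam * (n : ℝ)⁻¹ := by ring
        _ ≤ _ := by gcongr
    have h1 : C₁ * u ^ γ ≤ C * u ^ γ := by gcongr
    have h2 : 2 * L * T * t ≤ C * t := by gcongr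
    change _ ≤ C * (u ^ γ + t)
    rw [hC₁] at h1
    linarith
  · refine (measureReal_union_le _ _).trans ((add_le_add ((measureReal_union_le _ _).trans
      (add_le_add ((measureReal_union_le _ _).trans (add_le_add hb1 hb2)) hb3)) hb4).trans ?_)
    have h1 : (|CM| + 4) * (n : ℝ)⁻¹ ≤ C * (n : ℝ) ^ (-(1 - η)) :=
      mul_le_mul hCM' hinv (by positivity) hC0.le
    have h2 : 2 * d * E ≤ C * E := by gcongr
    have h3 : 0 ≤ C * (1 / ((n : ℝ) ^ η * Real.log n)) := by positivity
    linarith
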